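/- For an integer $N\ge 1$ write $N=(\text{odd})\cdot 2^{c+4d}$ with integers $0\le c\le 3$, $d\ge 0$, and let $\rho(N)=2^c+8d-1$ be the Hurwitz--Radon--Adams number (the maximal number of continuous, everywhere linearly independent vector fields on $\mathbb S^{N-1}$). A contact form on a manifold of dimension $2m+1$ is a smooth $1$-form $\omega$ such that $\omega\wedge(d\omega)^m$ vanishes nowhere; its Reeb vector field $R$ is defined by $\omega(R)=1$ and $R\lrcorner d\omega=0$. One-forms $\omega_1,\dots,\omega_{p+1}$ generate a contact $p$-sphere if $\sum_i\lambda_i\omega_i$ is a contact form for all real $\lambda_1,\dots,\lambda_{p+1}$ with $\sum_i\lambda_i^2=1$. The contact $p$-sphere is taut if the volume form $\omega\wedge(d\omega)^m$ is the same for all its elements $\omega=\sum_i\lambda_i\omega_i$ ($\sum_i\lambda_i^2=1$). It is round if, $R_1,\dots,R_{p+1}$ being the Reeb vector fields of $\omega_1,\dots,\omega_{p+1}$, the Reeb vector field of $\sum_i\lambda_i\omega_i$ is $\sum_i\lambda_iR_i$ whenever $\sum_i\lambda_i^2=1$. Theorem. Let $n\ge1$. There exist $\rho(4n)$ antisymmetric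 orthogonal real $4n\times4n$ matrices $A_1,\dots,A_{\rho(4n)}$ with $A_i^2=-\mathrm{Id}$ for all $i$ and $A_iA_j+A_jA_i=0$ for $i\ne j$. For every such family of matrices, the $1$-forms $\omega_i$ induced on the unit sphere $\mathbb S^{4n-1}\subset\mathbb R^{4n}$ by $\langle A_ix,dx\rangle$ $(1\le i\le\rho(4n))$ generate a contact $(\rho(4n)-1)$-sphere on $\mathbb S^{4n-1}$, and this contact $(\rho(4n)-1)$-sphere is round and taut. In particular $\mathbb S^{4n-1}$ carries a round and taut contact $(\rho(4n)-1)$-sphere. -/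

import Mathlib

open scoped Manifold ContDiff

noncomputable section

/-! ### Exterior algebra on a vector space -/

/-- The exterior product `a ∧ b` of alternating forms, normalised so that
`(a ∧ b)(v) = ∑ sgn(σ) a(v_σ(1), …, v_σ(k)) b(v_σ(k+1), …, v_σ(k+l))`, the sum being over
`(k, l)`-shuffles `σ`. -/
def wedge {V : Type*} [AddCommGroup V] [Module ℝ V] {k l : ℕ}
    (a : V [⋀^Fin k]→ₗ[ℝ] ℝ) (b : V [⋀^Fin l]→ₗ[ℝ] ℝ) : V [⋀^Fin (k + l)]→ₗ[ℝ] ℝ :=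
  ((LinearMap.mul' ℝ ℝ).compAlternatingMap (a.domCoprod b)).domDomCongr finSumFinEquiv

/-- The power `b ∧ ⋯ ∧ b` (`m` factors) of a two-form `b`. -/
def wedgePow {V : Type*} [AddCommGroup V] [Module ℝ V] (b : V [⋀^Fin 2]→ₗ[ℝ] ℝ) :
    (m : ℕ) → V [⋀^Fin (2 * m)]→ₗ[ℝ] ℝ
  | 0 =>
    haveI : IsEmpty (Fin (2 * 0)) := inferInstanceAs (IsEmpty (Fin 0))
    AlternatingMap.constOfIsEmpty ℝ V (Fin (2 * 0)) (1 : ℝ)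
  | m + 1 => wedge (wedgePow b m) b

/-! ### One-forms and contact forms on a manifold -/

/-- A (not necessarily smooth) one-form on a `d`-dimensional manifold. -/
abbrev OneForm (d : ℕ) (M : Type*) [TopologicalSpace M]
    [ChartedSpace (EuclideanSpace ℝ (Fin d)) M] : Type _ :=
  (x : M) → (TangentSpace (𝓡 d) x →L[ℝ] ℝ)

section Manifold

variable {d : ℕ} {M : Type*} [TopologicalSpace M] [ChartedSpace (EuclideanSpace ℝ (Fin d)) M]

/-- A one-form is smooth if it is smooth as a (fibrewise linear) function on the tangent bundle. -/
def OneForm.IsSmooth [IsManifold (𝓡 d) ∞ M] (η : OneForm d M) : Prop :=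
  haveI : IsManifold (𝓡 d) 1 M := IsManifold.of_le (n := ∞) (by simp)
  ContMDiff (𝓡 d).tangent 𝓘(ℝ, ℝ) ∞ (fun p : TangentBundle (𝓡 d) M => η p.1 p.2)

/-- The expression of `η` in the chart `φ` at `x₀`, i.e. the pull-back `(φ⁻¹)^* η`,
as a differential form (of degree one) on the model space. -/
def OneForm.inChart (η : OneForm d M) (x₀ : M) (y : EuclideanSpace ℝ (Fin d)) :
    EuclideanSpace ℝ (Fin d) [⋀^Fin 1]→L[ℝ] ℝ :=
  ContinuousAlternatingMap.ofSubsingleton ℝ (EuclideanSpace ℝ (Fin d)) ℝ (0 : Fin 1)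
    ((η ((extChartAt (𝓡 d) x₀).symm y)).comp
      (mfderiv 𝓘(ℝ, EuclideanSpace ℝ (Fin d)) (𝓡 d) (extChartAt (𝓡 d) x₀).symm y))

/-- The exterior derivative `dη` of a one-form at the point `x`, computed in the chart `φ` at `x`:
`(dη)_x = φ^* (d ((φ⁻¹)^* η))`. -/
def OneForm.extD (η : OneForm d M) (x : M) : TangentSpace (𝓡 d) x [⋀^Fin 2]→L[ℝ] ℝ :=
  (extDeriv (η.inChart x) (extChartAt (𝓡 d) x x)).compContinuousLinearMap
    (mfderiv (𝓡 d) 𝓘(ℝ, EuclideanSpace ℝ (Fin d)) (extChartAt (𝓡 d) x) x)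

/-- The form `η ∧ (dη)^m`, of degree `1 + 2 * m`, at the point `x`. -/
def OneForm.contactVolume (η : OneForm d M) (m : ℕ) (x : M) :
    TangentSpace (𝓡 d) x [⋀^Fin (1 + 2 * m)]→ₗ[ℝ] ℝ :=
  wedge (AlternatingMap.ofSubsingleton ℝ (TangentSpace (𝓡 d) x) ℝ (0 : Fin 1)
      (η x : TangentSpace (𝓡 d) x →ₗ[ℝ] ℝ))
    (wedgePow (η.extD x).toAlternatingMap m)

/-- `R` is the Reeb vector field of `η`: `η(R) = 1` and `R ⌟ dη = 0`.  For a contact form these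
two equations determine `R`, and force it to be smooth. -/
def OneForm.IsReebField (η : OneForm d M) (R : (x : M) → TangentSpace (𝓡 d) x) : Prop :=
  ∀ x : M, η x (R x) = 1 ∧ ∀ v : TangentSpace (𝓡 d) x, η.extD x ![R x, v] = 0

end Manifold

section Contact

variable {m : ℕ} {M : Type*} [TopologicalSpace M]
  [ChartedSpace (EuclideanSpace ℝ (Fin (2 * m + 1))) M]

/-- A contact form on a `(2m+1)`-dimensional manifold: a smooth one-form `η` such that
`η ∧ (dη)^m` is a volume form, i.e. a nowhere vanishing form of top degree. -/
def IsContactForm [IsManifold (𝓡 (2 * m + 1)) ∞ M] (η : OneForm (2 * m + 1) M) : Prop :=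
  η.IsSmooth ∧ ∀ x : M, η.contactVolume m x ≠ 0

/-- The linear combination `∑ λᵢ ηᵢ`. -/
def linComb {p : ℕ} (η : Fin (p + 1) → OneForm (2 * m + 1) M) (c : Fin (p + 1) → ℝ) :
    OneForm (2 * m + 1) M :=
  fun x => ∑ i, c i • η i x

/-- `η₁, …, η_{p+1}` generate a contact `p`-sphere. -/
def IsContactSphere [IsManifold (𝓡 (2 * m + 1)) ∞ M] {p : ℕ}
    (η : Fin (p + 1) → OneForm (2 * m + 1) M) : Prop :=
  ∀ c : Fin (p + 1) → ℝ, ∑ i, c i ^ 2 = 1 → IsContactForm (linComb η c)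

/-- The contact `p`-sphere generated by `η₁, …, η_{p+1}` is taut: all its elements generate the
same volume form. -/
def IsTaut {p : ℕ} (η : Fin (p + 1) → OneForm (2 * m + 1) M) : Prop :=
  ∀ c c' : Fin (p + 1) → ℝ, ∑ i, c i ^ 2 = 1 → ∑ i, c' i ^ 2 = 1 →
    ∀ x : M, (linComb η c).contactVolume m x = (linComb η c').contactVolume m x

/-- The contact `p`-sphere generated by `η₁, …, η_{p+1}` is round: if `R₁, …, R_{p+1}` are the Reeb
vector fields of the generators, every normalised combination `∑ λᵢ ηᵢ` has `∑ λᵢ Rᵢ` as its Reeb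
vector field. -/
def IsRound {p : ℕ} (η : Fin (p + 1) → OneForm (2 * m + 1) M) : Prop :=
  ∃ R : Fin (p + 1) → (x : M) → TangentSpace (𝓡 (2 * m + 1)) x,
    (∀ i, (η i).IsReebField (R i)) ∧
    ∀ c : Fin (p + 1) → ℝ, ∑ i, c i ^ 2 = 1 →
      (linComb η c).IsReebField (fun x => ∑ i, c i • R i x)

end Contact

/-! ### The Hurwitz–Radon–Adams number, anticommuting complex structures, and the sphere -/

/-- `ρ(N) = 2^c + 8 d - 1`, where `N = odd * 2^(c + 4 d)` and `c ≤ 3`. -/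
def hurwitzRadonAdams (N : ℕ) : ℕ :=
  2 ^ (padicValNat 2 N % 4) + 8 * (padicValNat 2 N / 4) - 1

/-- `ρ(4n) ≥ 1` (so that `ρ(4n) - 1` is not a truncated subtraction). -/
theorem hurwitzRadonAdams_pos (n : ℕ) [NeZero n] :
    hurwitzRadonAdams (4 * n) - 1 + 1 = hurwitzRadonAdams (4 * n) := by
  have hv : 2 ≤ padicValNat 2 (4 * n) := by
    rw [← padicValNat_dvd_iff_le (mul_ne_zero (by norm_num) (NeZero.ne n))]
    exact Dvd.intro n (by norm_num)
  unfold hurwitzRadonAdams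
  generalize padicValNat 2 (4 * n) = v at hv
  have h1 : 1 ≤ 2 ^ (v % 4) := Nat.one_le_two_pow
  rcases Nat.eq_zero_or_pos (v / 4) with h | h
  · have h2 : 2 ^ 1 ≤ 2 ^ (v % 4) := Nat.pow_le_pow_right (by norm_num) (by omega)
    omega
  · omega

/-- Anticommuting orthogonal complex structures on `ℝ^N`. -/
structure IsEckmannFamily {N : ℕ} {ι : Type*} (A : ι → Matrix (Fin N) (Fin N) ℝ) : Prop where
  orthogonal : ∀ i, A i ∈ Matrix.orthogonalGroup (Fin N) ℝ
  antisymm : ∀ i, (A i).transpose = -A i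
  sq : ∀ i, A i * A i = -1
  anticomm : ∀ i j, i ≠ j → A i * A j + A j * A i = 0

/-- `ℝ^{4n}` has dimension `(2 (2n - 1) + 1) + 1`; this makes its unit sphere a manifold of
dimension `2 (2n - 1) + 1 = 4n - 1`. -/
instance factFinrankFourMul (n : ℕ) [NeZero n] :
    Fact (Module.finrank ℝ (EuclideanSpace ℝ (Fin (4 * n))) = (2 * (2 * n - 1) + 1) + 1) :=
  ⟨by
    have := NeZero.pos n
    rw [finrank_euclideanSpace_fin]
    omega⟩

/-- The unit sphere `S^{4n-1}` of `ℝ^{4n}`. -/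
abbrev UnitSphere (n : ℕ) : Type :=
  Metric.sphere (0 : EuclideanSpace ℝ (Fin (4 * n))) 1

/-- The one-form on `S^{4n-1}` induced by the one-form `⟨A x, dx⟩` of `ℝ^{4n}`, that is, its
pull-back under the inclusion of the sphere. -/
def inducedForm (n : ℕ) [NeZero n] (A : Matrix (Fin (4 * n)) (Fin (4 * n)) ℝ) :
    OneForm (2 * (2 * n - 1) + 1) (UnitSphere n) :=
  fun x => (innerSL ℝ (Matrix.toEuclideanCLM (𝕜 := ℝ) A (x : EuclideanSpace ℝ (Fin (4 * n))))).comp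
    (mvfderiv (𝓡 (2 * (2 * n - 1) + 1))
      (fun y : UnitSphere n => (y : EuclideanSpace ℝ (Fin (4 * n)))) x)

end

/-! Existence is the classical Hurwitz–Radon construction. Kronecker products with the real Pauli
matrices and the plane rotation turn two commuting families into one in twice the dimension, which
gives 1, 3 and 7 matrices in dimensions 2, 4 and 8; a further factor 16 in the dimension adds 8
matrices (`HasHurwitzRadonFamily.mul_sixteen`).

For the contact sphere, anticommutation makes every B = ∑ cᵢ Aᵢ with |c| = 1 an orthogonal complex
structure (`IsEckmannFamily.linComb_sq`), so each element of the sphere is ω = ⟨Bx, dx⟩ with dω =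
2⟨B·, ·⟩ on tangent vectors (`extD_inducedForm`). The Reeb field is x ↦ Bx, which is linear in B:
this is roundness.

In a unitary frame starting at x, dω restricted to x^⊥ is twice a sum of m decomposable two-forms,
and ω ∧ (dω)^m is ± 2^m m! times Euclidean volume. Its square is therefore a Gram determinant in
which B does not occur (`contactVolume_inducedForm_sq`). This gives nonvanishing at once, and
tautness up to sign; the sign cannot jump because the parameter sphere is connected, ρ(4n) being at
least 2. -/

/-! ### Hurwitz–Radon families -/

section HurwitzRadon

open Matrix
open scoped Kronecker

/-- A family of pairwise anticommuting antisymmetric matrices with square `-1`. -/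
structure IsHurwitzRadonFamily {ι κ : Type*} [Fintype ι] [DecidableEq ι]
    (A : κ → Matrix ι ι ℝ) : Prop where
  antisymm : ∀ i, (A i)ᵀ = -A i
  sq : ∀ i, A i * A i = -1
  anticomm : ∀ i j, i ≠ j → A i * A j + A j * A i = 0

variable {ι ι' κ κ' : Type*}

theorem neg_kronecker (A : Matrix ι ι ℝ) (B : Matrix ι' ι' ℝ) : (-A) ⊗ₖ B = -(A ⊗ₖ B) := by
  ext; simp

theorem kronecker_neg (A : Matrix ι ι ℝ) (B : Matrix ι' ι' ℝ) : A ⊗ₖ (-B) = -(A ⊗ₖ B) := by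
  ext; simp

theorem kronecker_transpose (A : Matrix ι ι ℝ) (B : Matrix ι' ι' ℝ) :
    (A ⊗ₖ B)ᵀ = Aᵀ ⊗ₖ Bᵀ := rfl

theorem kronecker_mul [Fintype ι] [Fintype ι'] (A A' : Matrix ι ι ℝ) (B B' : Matrix ι' ι' ℝ) :
    (A ⊗ₖ B) * (A' ⊗ₖ B') = (A * A') ⊗ₖ (B * B') :=
  (mul_kronecker_mul A A' B B').symm

variable [Fintype ι] [DecidableEq ι] [Fintype ι'] [DecidableEq ι']

theorem IsHurwitzRadonFamily.comp {A : κ → Matrix ι ι ℝ} (hA : IsHurwitzRadonFamily A)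
    {f : κ' → κ} (hf : Function.Injective f) : IsHurwitzRadonFamily (A ∘ f) :=
  ⟨fun _ => hA.antisymm _, fun _ => hA.sq _, fun _ _ h => hA.anticomm _ _ (hf.ne h)⟩

theorem IsHurwitzRadonFamily.submatrix {A : κ → Matrix ι ι ℝ} (hA : IsHurwitzRadonFamily A)
    (e : ι' ≃ ι) : IsHurwitzRadonFamily (fun i => (A i).submatrix e e) where
  antisymm i := by rw [transpose_submatrix, hA.antisymm]; rfl
  sq i := by
    rw [submatrix_mul_equiv, hA.sq, submatrix_neg]
    simp
  anticomm i j h := by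
    rw [submatrix_mul_equiv, submatrix_mul_equiv]
    ext k l
    simpa using congrFun (congrFun (hA.anticomm i j h) (e k)) (e l)

theorem isHurwitzRadonFamily_of_isEmpty [IsEmpty κ] (A : κ → Matrix ι ι ℝ) :
    IsHurwitzRadonFamily A :=
  ⟨fun i => isEmptyElim i, fun i => isEmptyElim i, fun i => isEmptyElim i⟩

/-- Twisting by a commuting symmetric involution. -/
theorem IsHurwitzRadonFamily.kronecker {A : κ → Matrix ι ι ℝ} (hA : IsHurwitzRadonFamily A)
    {S : Matrix ι' ι' ℝ} (hS : Sᵀ = S) (hS2 : S * S = 1) :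
    IsHurwitzRadonFamily (fun i => A i ⊗ₖ S) where
  antisymm i := by rw [kronecker_transpose, hA.antisymm, hS, neg_kronecker]
  sq i := by rw [kronecker_mul, hA.sq, hS2, neg_kronecker, one_kronecker_one]
  anticomm i j h := by
    rw [kronecker_mul, kronecker_mul, ← add_kronecker, hA.anticomm i j h, zero_kronecker]

theorem IsHurwitzRadonFamily.one_kronecker {A : κ → Matrix ι' ι' ℝ}
    (hA : IsHurwitzRadonFamily A) :
    IsHurwitzRadonFamily (fun i => (1 : Matrix ι ι ℝ) ⊗ₖ A i) where
  antisymm i := by rw [kronecker_transpose, hA.antisymm, transpose_one, kronecker_neg]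
  sq i := by rw [kronecker_mul, hA.sq, one_mul, kronecker_neg, one_kronecker_one]
  anticomm i j h := by
    rw [kronecker_mul, kronecker_mul, ← kronecker_add, hA.anticomm i j h, kronecker_zero]

theorem IsHurwitzRadonFamily.sumElim {A : κ → Matrix ι ι ℝ} {B : κ' → Matrix ι ι ℝ}
    (hA : IsHurwitzRadonFamily A) (hB : IsHurwitzRadonFamily B)
    (h : ∀ i j, A i * B j + B j * A i = 0) : IsHurwitzRadonFamily (Sum.elim A B) where
  antisymm := by rintro (i | i) <;> simp [hA.antisymm, hB.antisymm]
  sq := by rintro (i | i) <;> simp [hA.sq, hB.sq]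
  anticomm := by
    rintro (i | i) (j | j) hij
    · exact hA.anticomm i j (by simpa using hij)
    · exact h i j
    · simpa [add_comm] using h j i
    · exact hB.anticomm i j (by simpa using hij)

/-- The real Pauli matrix `σ_x`. -/
def pauliX : Matrix (Fin 2) (Fin 2) ℝ := !![0, 1; 1, 0]

/-- The real Pauli matrix `σ_z`. -/
def pauliZ : Matrix (Fin 2) (Fin 2) ℝ := !![1, 0; 0, -1]

/-- The rotation of the plane by a right angle. -/
def rotJ : Matrix (Fin 2) (Fin 2) ℝ := !![0, -1; 1, 0]

theorem pauliX_transpose : pauliXᵀ = pauliX := by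
  ext i j; fin_cases i <;> fin_cases j <;> simp [pauliX]

theorem pauliZ_transpose : pauliZᵀ = pauliZ := by
  ext i j; fin_cases i <;> fin_cases j <;> simp [pauliZ]

theorem rotJ_transpose : rotJᵀ = -rotJ := by
  ext i j; fin_cases i <;> fin_cases j <;> simp [rotJ]

theorem pauliX_sq : pauliX * pauliX = 1 := by
  ext i j; fin_cases i <;> fin_cases j <;> simp [pauliX]

theorem pauliZ_sq : pauliZ * pauliZ = 1 := by
  ext i j; fin_cases i <;> fin_cases j <;> simp [pauliZ]

theorem rotJ_sq : rotJ * rotJ = -1 := by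
  ext i j; fin_cases i <;> fin_cases j <;> simp [rotJ]

theorem pauliX_mul_pauliZ : pauliX * pauliZ = -(pauliZ * pauliX) := by
  ext i j; fin_cases i <;> fin_cases j <;> simp [pauliX, pauliZ]

theorem rotJ_mul_pauliX : rotJ * pauliX = -(pauliX * rotJ) := by
  ext i j; fin_cases i <;> fin_cases j <;> simp [pauliX, rotJ]

theorem rotJ_mul_pauliZ : rotJ * pauliZ = -(pauliZ * rotJ) := by
  ext i j; fin_cases i <;> fin_cases j <;> simp [pauliZ, rotJ]

theorem isHurwitzRadonFamily_rotJ : IsHurwitzRadonFamily (fun _ : Unit => rotJ) :=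
  ⟨fun _ => rotJ_transpose, fun _ => rotJ_sq, fun _ _ h => (h rfl).elim⟩

/-- Two commuting families combine to a family in twice the dimension. -/
theorem IsHurwitzRadonFamily.double {A : κ → Matrix ι ι ℝ} {B : κ' → Matrix ι ι ℝ}
    (hA : IsHurwitzRadonFamily A) (hB : IsHurwitzRadonFamily B)
    (h : ∀ i j, A i * B j = B j * A i) :
    IsHurwitzRadonFamily (Sum.elim (Sum.elim (fun i => A i ⊗ₖ pauliX) (fun i => B i ⊗ₖ pauliZ))
      (fun _ : Unit => (1 : Matrix ι ι ℝ) ⊗ₖ rotJ)) := by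
  -- The blocks anticommute because `pauliX`, `pauliZ` and `rotJ` do so pairwise, while their left
  -- factors commute.
  refine ((hA.kronecker pauliX_transpose pauliX_sq).sumElim
    (hB.kronecker pauliZ_transpose pauliZ_sq) fun i j => ?_).sumElim
    isHurwitzRadonFamily_rotJ.one_kronecker ?_
  · rw [kronecker_mul, kronecker_mul, h, pauliX_mul_pauliZ, kronecker_neg, neg_add_cancel]
  · rintro (i | i) -
    · simp [kronecker_mul, rotJ_mul_pauliX, kronecker_neg]
    · simp [kronecker_mul, rotJ_mul_pauliZ, kronecker_neg]

/-- Left and right multiplication by the quaternionic units. -/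
theorem exists_quaternionic_families :
    ∃ A B : (Unit ⊕ Unit) ⊕ Unit → Matrix (Fin 2 × Fin 2) (Fin 2 × Fin 2) ℝ,
      IsHurwitzRadonFamily A ∧ IsHurwitzRadonFamily B ∧ ∀ i j, A i * B j = B j * A i := by
  -- The second family is the first with its two tensor factors exchanged. Members of the two
  -- families commute because signs appear in both factors or in neither.
  refine ⟨_, Sum.elim (Sum.elim (fun _ => pauliX ⊗ₖ rotJ) fun _ => pauliZ ⊗ₖ rotJ)
    fun _ => rotJ ⊗ₖ 1, isHurwitzRadonFamily_rotJ.double isHurwitzRadonFamily_rotJ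
      (fun _ _ => rfl), ⟨?_, ?_, ?_⟩, ?_⟩
  · rintro ((i | i) | i) <;>
      simp [kronecker_transpose, pauliX_transpose, pauliZ_transpose, rotJ_transpose,
        kronecker_neg, neg_kronecker]
  · rintro ((i | i) | i) <;>
      simp [kronecker_mul, pauliX_sq, pauliZ_sq, rotJ_sq, kronecker_neg, neg_kronecker]
  · rintro ((i | i) | i) ((j | j) | j) hij <;>
      first
      | exact (hij rfl).elim
      | simp [kronecker_mul, pauliX_mul_pauliZ, rotJ_mul_pauliX, rotJ_mul_pauliZ, neg_kronecker]
  · rintro ((i | i) | i) ((j | j) | j) <;>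
      simp [kronecker_mul, rotJ_mul_pauliX, rotJ_mul_pauliZ, neg_kronecker, kronecker_neg]

/-- The seven units of the octonions. -/
theorem exists_octonionic_family :
    ∃ A : Fin 7 → Matrix ((Fin 2 × Fin 2) × Fin 2) ((Fin 2 × Fin 2) × Fin 2) ℝ,
      IsHurwitzRadonFamily A := by
  obtain ⟨A, B, hA, hB, h⟩ := exists_quaternionic_families
  have e : Fin 7 ≃ (((Unit ⊕ Unit) ⊕ Unit) ⊕ ((Unit ⊕ Unit) ⊕ Unit)) ⊕ Unit :=
    Fintype.equivOfCardEq (by simp)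
  exact ⟨_, (hA.double hB h).comp e.injective⟩

/-- A family of eight matrices in dimension sixteen, anticommuting with a symmetric involution. -/
theorem exists_family_sixteen :
    ∃ (A : Fin 8 → Matrix (Fin 16) (Fin 16) ℝ) (S : Matrix (Fin 16) (Fin 16) ℝ),
      IsHurwitzRadonFamily A ∧ Sᵀ = S ∧ S * S = 1 ∧ ∀ i, S * A i = -(A i * S) := by
  obtain ⟨A, hA⟩ := exists_octonionic_family
  -- With an empty second family, doubling gives 7 + 0 + 1 matrices and leaves the `pauliZ` slot
  -- free: 1 ⊗ `pauliZ` is the involution.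
  let B : Empty → Matrix ((Fin 2 × Fin 2) × Fin 2) ((Fin 2 × Fin 2) × Fin 2) ℝ := isEmptyElim
  have hC := hA.double (isHurwitzRadonFamily_of_isEmpty B) fun _ j => j.elim
  have e : Fin 8 ≃ (Fin 7 ⊕ Empty) ⊕ Unit := Fintype.equivOfCardEq (by simp)
  have f : Fin 16 ≃ ((Fin 2 × Fin 2) × Fin 2) × Fin 2 := Fintype.equivOfCardEq (by simp)
  refine ⟨_, ((1 : Matrix ((Fin 2 × Fin 2) × Fin 2) _ ℝ) ⊗ₖ pauliZ).submatrix f f,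
    (hC.comp e.injective).submatrix f, ?_, ?_, fun i => ?_⟩
  · rw [transpose_submatrix, kronecker_transpose, pauliZ_transpose, transpose_one]
  · rw [submatrix_mul_equiv, kronecker_mul, pauliZ_sq, one_mul, one_kronecker_one,
      submatrix_one_equiv]
  · rw [submatrix_mul_equiv, submatrix_mul_equiv]
    change _ = (-(_ * _) : Matrix _ _ ℝ).submatrix f f
    congr 1
    rcases h : e i with (j | j) | j
    · simp [h, kronecker_mul, pauliX_mul_pauliZ, kronecker_neg]
    · exact j.elim
    · simp [h, kronecker_mul, rotJ_mul_pauliZ, kronecker_neg]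

/-- There is a family of `k` anticommuting complex structures in dimension `N`. -/
def HasHurwitzRadonFamily (N k : ℕ) : Prop :=
  ∃ A : Fin k → Matrix (Fin N) (Fin N) ℝ, IsHurwitzRadonFamily A

theorem IsHurwitzRadonFamily.hasHurwitzRadonFamily [Fintype κ] {A : κ → Matrix ι ι ℝ}
    (hA : IsHurwitzRadonFamily A) {N k : ℕ} (hN : Fintype.card ι = N) (hk : Fintype.card κ = k) :
    HasHurwitzRadonFamily N k :=
  ⟨_, (hA.comp (Fintype.equivOfCardEq (α := Fin k) (by simp [hk])).injective).submatrix
    (Fintype.equivOfCardEq (by simp [hN]))⟩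

theorem HasHurwitzRadonFamily.mul_right {N k : ℕ} (h : HasHurwitzRadonFamily N k) (r : ℕ) :
    HasHurwitzRadonFamily (N * r) k := by
  obtain ⟨A, hA⟩ := h
  exact (hA.kronecker (S := (1 : Matrix (Fin r) (Fin r) ℝ)) transpose_one
    (one_mul 1)).hasHurwitzRadonFamily (by simp) (by simp)

/-- The matrices are Aᵢ ⊗ S and 1 ⊗ Bⱼ; the two kinds anticommute because S anticommutes with every
Bⱼ. -/
theorem HasHurwitzRadonFamily.mul_sixteen {N k : ℕ} (h : HasHurwitzRadonFamily N k) :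
    HasHurwitzRadonFamily (N * 16) (k + 8) := by
  obtain ⟨A, hA⟩ := h
  obtain ⟨B, S, hB, hS, hS2, hSB⟩ := exists_family_sixteen
  refine ((hA.kronecker hS hS2).sumElim (hB.one_kronecker (ι := Fin N))
    fun i j => ?_).hasHurwitzRadonFamily (by simp) (by simp)
  simp [kronecker_mul, hSB, kronecker_neg]

theorem hasHurwitzRadonFamily_two_pow (c d : ℕ) (hc : c < 4) :
    HasHurwitzRadonFamily (2 ^ (c + 4 * d)) (2 ^ c + 8 * d - 1) := by
  induction d with
  | zero =>
    -- The base cases are the imaginary units of the reals, complex numbers, quaternions and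
    -- octonions.
    interval_cases c
    · exact (isHurwitzRadonFamily_of_isEmpty fun _ : Empty =>
        (1 : Matrix (Fin 1) (Fin 1) ℝ)).hasHurwitzRadonFamily (by simp) (by simp)
    · exact isHurwitzRadonFamily_rotJ.hasHurwitzRadonFamily (by simp) (by simp)
    · obtain ⟨A, -, hA, -⟩ := exists_quaternionic_families
      exact hA.hasHurwitzRadonFamily (by simp) (by simp)
    · obtain ⟨A, hA⟩ := exists_octonionic_family
      exact hA.hasHurwitzRadonFamily (by simp) (by simp)
  | succ d ih =>
    have h1 : 2 ^ (c + 4 * (d + 1)) = 2 ^ (c + 4 * d) * 16 := by ring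
    have h2 : 2 ^ c + 8 * (d + 1) - 1 = 2 ^ c + 8 * d - 1 + 8 := by
      have := Nat.one_le_two_pow (n := c)
      omega
    rw [h1, h2]
    exact ih.mul_sixteen

theorem hasHurwitzRadonFamily_hurwitzRadonAdams (N : ℕ) :
    HasHurwitzRadonFamily N (hurwitzRadonAdams N) := by
  have h := hasHurwitzRadonFamily_two_pow (padicValNat 2 N % 4) (padicValNat 2 N / 4)
    (Nat.mod_lt _ (by norm_num))
  rw [Nat.mod_add_div] at h
  obtain ⟨r, hr⟩ := pow_padicValNat_dvd (p := 2) (n := N)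
  have h' := h.mul_right r
  rwa [← hr] at h'

theorem exists_isEckmannFamily (n : ℕ) [NeZero n] :
    ∃ A : Fin (hurwitzRadonAdams (4 * n) - 1 + 1) → Matrix (Fin (4 * n)) (Fin (4 * n)) ℝ,
      IsEckmannFamily A := by
  rw [hurwitzRadonAdams_pos]
  obtain ⟨A, hA⟩ := hasHurwitzRadonFamily_hurwitzRadonAdams (4 * n)
  refine ⟨A, fun i => ?_, hA.antisymm, hA.sq, hA.anticomm⟩
  rw [Matrix.mem_orthogonalGroup_iff, hA.antisymm, mul_neg, hA.sq, neg_neg]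

end HurwitzRadon

/-! ### Wedge products of one-forms -/

section Wedge

variable {V : Type*} [AddCommGroup V] [Module ℝ V]

theorem alternatingMap_sum_apply {N ι κ : Type*} [AddCommGroup N] [Module ℝ N]
    (s : Finset κ) (f : κ → V [⋀^ι]→ₗ[ℝ] N)
    (v : ι → V) : (∑ i ∈ s, f i) v = ∑ i ∈ s, f i v := by
  classical
  induction s using Finset.induction_on with
  | empty => simp
  | insert i s hi ih => rw [Finset.sum_insert hi, Finset.sum_insert hi, ← ih]; rfl

/-- The exterior product of a family of linear forms. -/
def detForm {ι : Type*} [Fintype ι] [DecidableEq ι] (f : ι → V →ₗ[ℝ] ℝ) : V [⋀^ι]→ₗ[ℝ] ℝ :=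
  MultilinearMap.alternatization ((MultilinearMap.mkPiAlgebra ℝ ι ℝ).compLinearMap f)

theorem detForm_apply {ι : Type*} [Fintype ι] [DecidableEq ι] (f : ι → V →ₗ[ℝ] ℝ) (v : ι → V) :
    detForm f v = (Matrix.of fun i j => f i (v j)).det := by
  rw [detForm, MultilinearMap.alternatization_apply, ← Matrix.det_transpose, Matrix.det_apply]
  simp

theorem detForm_comp_equiv {ι κ : Type*} [Fintype ι] [DecidableEq ι] [Fintype κ] [DecidableEq κ]
    (f : ι → V →ₗ[ℝ] ℝ) (e : κ ≃ ι) (v : ι → V) :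
    detForm (f ∘ e) (v ∘ e) = detForm f v := by
  rw [detForm_apply, detForm_apply, ← Matrix.det_submatrix_equiv_self e]
  rfl

variable {k l : ℕ}

/-- Both factors are alternatizations, and in the shuffle normalisation the product of
alternatizations is the alternatization of the tensor product, with no factorial. -/
theorem wedge_detForm (f : Fin k → V →ₗ[ℝ] ℝ) (g : Fin l → V →ₗ[ℝ] ℝ) (v : Fin (k + l) → V) :
    wedge (detForm f) (detForm g) v = detForm (Sum.elim f g) (v ∘ finSumFinEquiv) := by
  rw [wedge, detForm, detForm, ← MultilinearMap.domCoprod_alternization,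
    AlternatingMap.domDomCongr_apply, ← LinearMap.compMultilinearMap_alternatization, detForm,
    MultilinearMap.alternatization_apply, MultilinearMap.alternatization_apply]
  refine Finset.sum_congr rfl fun σ _ => ?_
  simp [Function.comp_def]

theorem wedge_eq (a : V [⋀^Fin k]→ₗ[ℝ] ℝ) (b : V [⋀^Fin l]→ₗ[ℝ] ℝ) (v : Fin (k + l) → V) :
    wedge a b v = LinearMap.mul' ℝ ℝ
      (AlternatingMap.domCoprod' (TensorProduct.tmul ℝ a b) (v ∘ finSumFinEquiv)) :=
  rfl

theorem wedge_smul_smul (c d : ℝ) (a : V [⋀^Fin k]→ₗ[ℝ] ℝ) (b : V [⋀^Fin l]→ₗ[ℝ] ℝ) :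
    wedge (c • a) (d • b) = (c * d) • wedge a b := by
  ext v
  rw [AlternatingMap.smul_apply, wedge_eq, wedge_eq, TensorProduct.smul_tmul_smul, map_smul,
    AlternatingMap.smul_apply, map_smul]

theorem wedge_sum_sum {ι κ : Type*} [Fintype ι] [Fintype κ] (a : ι → V [⋀^Fin k]→ₗ[ℝ] ℝ)
    (b : κ → V [⋀^Fin l]→ₗ[ℝ] ℝ) :
    wedge (∑ i, a i) (∑ j, b j) = ∑ i, ∑ j, wedge (a i) (b j) := by
  ext v
  simp only [alternatingMap_sum_apply]
  rw [wedge_eq, TensorProduct.sum_tmul]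
  simp only [TensorProduct.tmul_sum, map_sum, alternatingMap_sum_apply]
  rfl

theorem wedgePow_smul (c : ℝ) (b : V [⋀^Fin 2]→ₗ[ℝ] ℝ) (m : ℕ) :
    wedgePow (c • b) m = c ^ m • wedgePow b m := by
  induction m with
  | zero => simp [wedgePow]
  | succ m ih => rw [wedgePow, wedgePow, ih, wedge_smul_smul, pow_succ]

/-- A finite sum over shuffles of products of values, so continuity may be tested on fixed vectors.
It serves to vary the coefficients of the contact sphere. -/
theorem continuous_wedge {X : Type*} [TopologicalSpace X] {a : X → V [⋀^Fin k]→ₗ[ℝ] ℝ}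
    {b : X → V [⋀^Fin l]→ₗ[ℝ] ℝ} (ha : ∀ v, Continuous fun t => a t v)
    (hb : ∀ v, Continuous fun t => b t v) (v : Fin (k + l) → V) :
    Continuous fun t => wedge (a t) (b t) v := by
  have h : ∀ t, wedge (a t) (b t) v = ∑ σ, LinearMap.mul' ℝ ℝ
      (AlternatingMap.domCoprod.summand (a t) (b t) σ (v ∘ finSumFinEquiv)) := fun t => by
    rw [← map_sum, ← _root_.sum_apply]
    rfl
  simp_rw [h]
  refine continuous_finsetSum _ fun σ _ => ?_
  induction σ using Quotient.inductionOn' with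
  | h σ =>
    have h' : ∀ t, LinearMap.mul' ℝ ℝ
        (AlternatingMap.domCoprod.summand (a t) (b t) (Quotient.mk'' σ) (v ∘ finSumFinEquiv)) =
        Equiv.Perm.sign σ • (a t (fun i => v (finSumFinEquiv (σ (Sum.inl i)))) *
          b t (fun i => v (finSumFinEquiv (σ (Sum.inr i))))) := fun t => by
      rw [AlternatingMap.domCoprod.summand_mk'', _root_.smul_apply,
        LinearMap.map_smul_of_tower]
      rfl
    simp_rw [h']
    exact ((ha _).mul (hb _)).const_smul _

theorem continuous_wedgePow {X : Type*} [TopologicalSpace X] {b : X → V [⋀^Fin 2]→ₗ[ℝ] ℝ}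
    (hb : ∀ v, Continuous fun t => b t v) (m : ℕ) (v : Fin (2 * m) → V) :
    Continuous fun t => wedgePow (b t) m v := by
  induction m with
  | zero => exact continuous_const
  | succ m ih => exact continuous_wedge ih hb v

/-- Splitting `2m` indices into `m` consecutive pairs. -/
def pairEquiv (m : ℕ) : Fin m × Fin 2 ≃ Fin (2 * m) :=
  finProdFinEquiv.trans (finCongr (mul_comm m 2))

/-- Splitting off the last pair. -/
def prodSnocEquiv (m : ℕ) : (Fin m × Fin 2) ⊕ Fin 2 ≃ Fin (m + 1) × Fin 2 :=
  ((pairEquiv m).sumCongr (Equiv.refl _)).trans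
    (finSumFinEquiv.trans (pairEquiv (m + 1)).symm)

theorem prodSnocEquiv_inl (m : ℕ) (p : Fin m × Fin 2) :
    prodSnocEquiv m (Sum.inl p) = (p.1.castSucc, p.2) := by
  rw [prodSnocEquiv, Equiv.trans_apply, Equiv.trans_apply, Equiv.symm_apply_eq]
  ext
  simp [pairEquiv]

theorem prodSnocEquiv_inr (m : ℕ) (s : Fin 2) :
    prodSnocEquiv m (Sum.inr s) = (Fin.last m, s) := by
  rw [prodSnocEquiv, Equiv.trans_apply, Equiv.trans_apply, Equiv.symm_apply_eq]
  ext
  simp [pairEquiv]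
  ring

/-- Distributivity: one summand is chosen in each of the m factors. In the induction `Fin.snoc`
records the choice made in the last factor. -/
theorem wedgePow_sum_detForm {K : Type*} [Fintype K] (G : K → Fin 2 → V →ₗ[ℝ] ℝ) (m : ℕ) :
    wedgePow (∑ i, detForm (G i)) m = ∑ I : Fin m → K,
      detForm ((fun p : Fin m × Fin 2 => G (I p.1) p.2) ∘ (pairEquiv m).symm) := by
  induction m with
  | zero =>
    ext v
    simp [wedgePow, detForm_apply]
  | succ m ih =>
    rw [wedgePow, ih, wedge_sum_sum, ← Fintype.sum_prod_type',
      ← (Fin.snocEquiv fun _ : Fin (m + 1) => K).sum_comp, ← (Equiv.prodComm _ _).sum_comp]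
    refine Finset.sum_congr rfl fun x _ => ?_
    ext v
    rw [wedge_detForm, ← detForm_comp_equiv _ ((pairEquiv m).sumCongr (Equiv.refl (Fin 2))),
      ← detForm_comp_equiv _ ((prodSnocEquiv m).trans (pairEquiv (m + 1))) v]
    congr 1
    · congr 1
      ext (p | s) : 1
      · simp [prodSnocEquiv_inl, Fin.snocEquiv]
      · simp [prodSnocEquiv_inr, Fin.snocEquiv]
    · ext (p | s) : 1 <;> simp [prodSnocEquiv]

/-- The exterior product of a one-form and a power of a sum of `m` decomposable two-forms. -/
theorem wedge_wedgePow_sum_detForm {m : ℕ} (a : V →ₗ[ℝ] ℝ) (G : Fin m → Fin 2 → V →ₗ[ℝ] ℝ)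
    (v : Fin (1 + 2 * m) → V) :
    wedge (AlternatingMap.ofSubsingleton ℝ V ℝ (0 : Fin 1) a)
        (wedgePow (∑ i, detForm (G i)) m) v =
      m.factorial * detForm (Sum.elim (fun _ : Fin 1 => a) fun p : Fin m × Fin 2 => G p.1 p.2)
        (v ∘ finSumFinEquiv ∘ (Equiv.refl (Fin 1)).sumCongr (pairEquiv m)) := by
  have ha : AlternatingMap.ofSubsingleton ℝ V ℝ (0 : Fin 1) a = detForm fun _ : Fin 1 => a := by
    ext v
    simp [detForm_apply]
  have hsum := wedge_sum_sum (fun _ : Unit => detForm fun _ : Fin 1 => a)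
    fun I : Fin m → Fin m =>
      detForm ((fun p : Fin m × Fin 2 => G (I p.1) p.2) ∘ (pairEquiv m).symm)
  simp only [Finset.univ_unique, Finset.sum_singleton] at hsum
  rw [ha, wedgePow_sum_detForm, hsum, alternatingMap_sum_apply]
  have key : ∀ I : Fin m → Fin m, wedge (detForm fun _ : Fin 1 => a)
      (detForm ((fun p : Fin m × Fin 2 => G (I p.1) p.2) ∘ (pairEquiv m).symm)) v =
      detForm (Sum.elim (fun _ : Fin 1 => a) fun p : Fin m × Fin 2 => G (I p.1) p.2)
        (v ∘ finSumFinEquiv ∘ (Equiv.refl (Fin 1)).sumCongr (pairEquiv m)) := fun I => by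
    rw [wedge_detForm, ← detForm_comp_equiv _ ((Equiv.refl (Fin 1)).sumCongr (pairEquiv m))]
    congr 1
    congr 1
    ext (p | s) : 1 <;> simp
  simp_rw [key]
  set w := v ∘ finSumFinEquiv ∘ (Equiv.refl (Fin 1)).sumCongr (pairEquiv m)
  -- Permuting pairs applies σ once in each of the two slots, so the sign is sgn(σ)² = 1: two-forms
  -- commute.
  have hperm : ∀ σ : Equiv.Perm (Fin m),
      detForm (Sum.elim (fun _ : Fin 1 => a) fun p : Fin m × Fin 2 => G (σ p.1) p.2) w =
      detForm (Sum.elim (fun _ : Fin 1 => a) fun p : Fin m × Fin 2 => G p.1 p.2) w := fun σ => by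
    have hs : Equiv.Perm.sign
        ((1 : Equiv.Perm (Fin 1)).sumCongr (Equiv.prodCongrLeft fun _ : Fin 2 => σ)) = 1 := by
      rw [Equiv.Perm.sign_sumCongr, Equiv.Perm.sign_prodCongrLeft]
      simp
    have h := Matrix.det_permute
      ((1 : Equiv.Perm (Fin 1)).sumCongr (Equiv.prodCongrLeft fun _ : Fin 2 => σ))
      (Matrix.of fun i j => Sum.elim (fun _ : Fin 1 => a) (fun p : Fin m × Fin 2 => G p.1 p.2) i
        (w j))
    rw [hs, Units.val_one, Int.cast_one, one_mul] at h
    rw [detForm_apply, detForm_apply, ← h]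
    congr 1
    ext (i | i) j <;> rfl
  -- A repeated two-form repeats a row of the determinant. Only the m! permutations survive.
  have hzero : ∀ I : Fin m → Fin m, ¬ Function.Injective I →
      detForm (Sum.elim (fun _ : Fin 1 => a) fun p : Fin m × Fin 2 => G (I p.1) p.2) w = 0 := by
    intro I hI
    obtain ⟨i, j, hij, hne⟩ := Function.not_injective_iff.1 hI
    rw [detForm_apply]
    refine Matrix.det_zero_of_row_eq (i := Sum.inr (i, 0)) (j := Sum.inr (j, 0))
      (by simpa using hne) ?_
    ext c
    simp [hij]
  rw [← Finset.sum_subset (Finset.subset_univ (Finset.univ.map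
    ⟨fun σ : Equiv.Perm (Fin m) => ⇑σ, DFunLike.coe_injective⟩)) fun I _ hI => hzero I fun h => hI ?_,
    Finset.sum_map]
  · simp [hperm, Fintype.card_perm]
  · exact Finset.mem_map.2 ⟨Equiv.ofBijective I (Finite.injective_iff_bijective.1 h),
      Finset.mem_univ _, rfl⟩

end Wedge

/-! ### Unitary frames -/

section Frame

variable {E : Type*} [NormedAddCommGroup E] [InnerProductSpace ℝ E]

/-- `B` is an orthogonal complex structure. -/
structure IsOrthogonalComplexStructure (B : E →L[ℝ] E) : Prop where
  skew : ∀ u v, inner ℝ (B u) v = -inner ℝ u (B v)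
  sq : ∀ u, B (B u) = -u

namespace IsOrthogonalComplexStructure

variable {B : E →L[ℝ] E}

theorem inner_map_map (hB : IsOrthogonalComplexStructure B) (u v : E) :
    inner ℝ (B u) (B v) = inner ℝ u v := by
  rw [hB.skew, hB.sq, inner_neg_right, neg_neg]

theorem inner_self_map (hB : IsOrthogonalComplexStructure B) (u : E) :
    inner ℝ u (B u) = 0 := by
  have := hB.skew u u
  rw [real_inner_comm] at this
  linarith

/-- The relations having B eᵢ on the left follow from these two, since B is skew and isometric. -/
theorem orthonormal_pairs_iff (hB : IsOrthogonalComplexStructure B) {k : ℕ} (e : Fin k → E) :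
    (Orthonormal ℝ fun p : Fin k × Fin 2 => ![e p.1, B (e p.1)] p.2) ↔
      ∀ i j, inner ℝ (e i) (e j) = (if i = j then 1 else 0) ∧ inner ℝ (e i) (B (e j)) = 0 := by
  rw [orthonormal_iff_ite]
  constructor
  · intro h i j
    have h0 := h (i, 0) (j, 0)
    have h1 := h (i, 0) (j, 1)
    simp only [Matrix.cons_val_zero, Matrix.cons_val_one, Prod.mk.injEq, and_true, zero_ne_one,
      and_false, if_false] at h0 h1
    exact ⟨h0, h1⟩
  · rintro h ⟨i, s⟩ ⟨j, t⟩
    have h1 := (h i j).1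
    have h2 := (h i j).2
    have h3 := hB.skew (e i) (e j)
    rw [h2, neg_zero] at h3
    have h4 := hB.inner_map_map (e i) (e j)
    fin_cases s <;> fin_cases t <;> simp [h1, h2, h3, h4]

/-- A unit vector is the first vector of a unitary frame. -/
theorem exists_frame [FiniteDimensional ℝ E] (hB : IsOrthogonalComplexStructure B) {m : ℕ}
    (hm : Module.finrank ℝ E = 2 * (m + 1)) {x : E} (hx : ‖x‖ = 1) (k : ℕ) (hk : k ≤ m) :
    ∃ e : Fin (k + 1) → E, e 0 = x ∧
      Orthonormal ℝ fun p : Fin (k + 1) × Fin 2 => ![e p.1, B (e p.1)] p.2 := by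
  induction k with
  | zero =>
    refine ⟨fun _ => x, rfl, (hB.orthonormal_pairs_iff _).2 fun i j => ⟨?_, hB.inner_self_map x⟩⟩
    rw [if_pos (Subsingleton.elim (α := Fin 1) i j), real_inner_self_eq_norm_sq, hx, one_pow]
  | succ k ih =>
    obtain ⟨e, he0, he⟩ := ih (by omega)
    -- F is B-invariant of dimension 2(k + 1) < 2(m + 1). A unit vector u orthogonal to F exists,
    -- and B u is then orthogonal to F too.
    set F := Submodule.span ℝ (Set.range fun p : Fin (k + 1) × Fin 2 => ![e p.1, B (e p.1)] p.2)
    have hF : Module.finrank ℝ F = (k + 1) * 2 := by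
      rw [finrank_span_eq_card he.linearIndependent]
      simp
    have hFo : Fᗮ ≠ ⊥ := by
      intro h
      have := F.finrank_add_finrank_orthogonal
      rw [h, finrank_bot, hF, hm] at this
      omega
    obtain ⟨w, hw, hw0⟩ := Submodule.exists_mem_ne_zero_of_ne_bot hFo
    set u := ‖w‖⁻¹ • w
    have hu : ‖u‖ = 1 := by
      rw [norm_smul, norm_inv, norm_norm, inv_mul_cancel₀ (norm_ne_zero_iff.2 hw0)]
    have huF : ∀ z ∈ F, inner ℝ z u = 0 :=
      (Submodule.mem_orthogonal F u).1 (Fᗮ.smul_mem _ hw)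
    have hu1 : ∀ i, inner ℝ (e i) u = 0 := fun i =>
      huF _ (Submodule.subset_span ⟨(i, 0), rfl⟩)
    have hu2 : ∀ i, inner ℝ (B (e i)) u = 0 := fun i =>
      huF _ (Submodule.subset_span ⟨(i, 1), rfl⟩)
    rw [hB.orthonormal_pairs_iff] at he
    refine ⟨Fin.snoc e u, ?_, (hB.orthonormal_pairs_iff _).2 ?_⟩
    · rw [← Fin.castSucc_zero, Fin.snoc_castSucc, he0]
    · intro i j
      refine Fin.lastCases ?_ (fun i => ?_) i <;> refine Fin.lastCases ?_ (fun j => ?_) j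
      · simp [hu, hB.inner_self_map]
      · have h2 := hu2 j
        rw [real_inner_comm] at h2
        have h1 := hu1 j
        rw [real_inner_comm] at h1
        simp [h1, h2, (Fin.castSucc_lt_last j).ne']
      · have h2 := hB.skew (e i) u
        rw [hu2 i, eq_comm, neg_eq_zero] at h2
        simp [hu1 i, h2, (Fin.castSucc_lt_last i).ne]
      · simpa using he i j

variable {W : Type*} [AddCommGroup W] [Module ℝ W]

/-- The square of the volume form `ω ∧ Ω ^ m` on `x^⊥`, where `ω = ⟨Bx, ·⟩` and
`Ω = 2 ⟨B ·, ·⟩`, is given by the Gram determinant. -/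
theorem wedge_wedgePow_sq [FiniteDimensional ℝ E] (hB : IsOrthogonalComplexStructure B) {m : ℕ}
    (hm : Module.finrank ℝ E = 2 * (m + 1)) {x : E} (hx : ‖x‖ = 1) (T : W →ₗ[ℝ] E)
    (hT : ∀ w, inner ℝ x (T w) = 0) (a : W →ₗ[ℝ] ℝ) (ha : ∀ w, a w = inner ℝ (B x) (T w))
    (b : W [⋀^Fin 2]→ₗ[ℝ] ℝ) (hb : ∀ u, b u = 2 * inner ℝ (B (T (u 0))) (T (u 1)))
    (v : Fin (1 + 2 * m) → W) :
    (wedge (AlternatingMap.ofSubsingleton ℝ W ℝ (0 : Fin 1) a) (wedgePow b m) v) ^ 2 =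
      (2 ^ m * m.factorial) ^ 2 * (Matrix.of fun i j => inner ℝ (T (v i)) (T (v j))).det := by
  obtain ⟨e, he0, he⟩ := hB.exists_frame hm hx m le_rfl
  have hcard : Fintype.card (Fin (m + 1) × Fin 2) = Module.finrank ℝ E := by
    rw [hm]
    simp [mul_comm]
  let β : OrthonormalBasis (Fin (m + 1) × Fin 2) ℝ E :=
    OrthonormalBasis.mk he (by
      rw [(basisOfOrthonormalOfCardEqFinrank he hcard).span_eq.symm,
        coe_basisOfOrthonormalOfCardEqFinrank])
  have hβ : ∀ p, β p = ![e p.1, B (e p.1)] p.2 := fun p => by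
    rw [OrthonormalBasis.coe_mk]
  have hsum : ∀ y z : E, inner ℝ y z = ∑ i : Fin (m + 1),
      (inner ℝ (e i) y * inner ℝ (e i) z + inner ℝ (B (e i)) y * inner ℝ (B (e i)) z) := by
    intro y z
    rw [← β.sum_inner_mul_inner y z, Fintype.sum_prod_type]
    simp [hβ, real_inner_comm]
  -- The coordinates of T along the complex lines of e₁, …, eₘ. The line of e₀ = x contributes
  -- nothing to b, as ⟨x, T w⟩ = 0.
  let G : Fin m → Fin 2 → W →ₗ[ℝ] ℝ := fun i =>
    ![(innerₗ E (e i.succ)).comp T, (innerₗ E (B (e i.succ))).comp T]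
  have hbG : b = (2 : ℝ) • ∑ i, detForm (G i) := by
    ext u
    rw [AlternatingMap.smul_apply, alternatingMap_sum_apply, hb, hsum, Fin.sum_univ_succ, he0,
      hB.inner_map_map, hT, hT, mul_zero, zero_mul, add_zero, zero_add, smul_eq_mul]
    congr 1
    refine Finset.sum_congr rfl fun i _ => ?_
    have h := hB.skew (e i.succ) (T (u 0))
    rw [hB.inner_map_map, detForm_apply, Matrix.det_fin_two]
    simp only [G, Matrix.of_apply, Matrix.cons_val_zero, Matrix.cons_val_one,
      LinearMap.comp_apply, innerₗ_apply_apply]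
    linear_combination inner ℝ (e i.succ) (T (u 1)) * h
  rw [hbG, wedgePow_smul]
  have h1 := wedge_smul_smul 1 ((2 : ℝ) ^ m) (AlternatingMap.ofSubsingleton ℝ W ℝ (0 : Fin 1) a)
    (wedgePow (∑ i, detForm (G i)) m)
  rw [one_smul, one_mul] at h1
  rw [h1, AlternatingMap.smul_apply, wedge_wedgePow_sum_detForm, smul_eq_mul, ← mul_assoc, mul_pow]
  congr 1
  set τ := (Equiv.refl (Fin 1)).sumCongr (pairEquiv m) |>.trans finSumFinEquiv
  change (detForm _ (v ∘ τ)) ^ 2 = _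
  -- For the coordinate matrix M, det(M)² = det(Mᵀ M), and Mᵀ M is the Gram matrix by Parseval
  -- because the missing coordinate, along x, is zero. Squaring removes the orientation of the
  -- frame.
  rw [detForm_apply, ← Matrix.det_submatrix_equiv_self τ
    (Matrix.of fun i j => inner ℝ (T (v i)) (T (v j))), pow_two]
  nth_rewrite 1 [← Matrix.det_transpose]
  rw [← Matrix.det_mul]
  congr 1
  ext i j
  rw [Matrix.mul_apply, Fintype.sum_sum_type, Fintype.sum_prod_type]
  simp [G, ha, hsum (T (v (τ i))), Fin.sum_univ_succ, he0, hT]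

end IsOrthogonalComplexStructure
end Frame

/-! ### Forms induced on the sphere -/

section Sphere

variable {n : ℕ} [NeZero n]

/-- The differential of the inclusion of the sphere. -/
noncomputable abbrev sphereIncl (x : UnitSphere n) :
    TangentSpace (𝓡 (2 * (2 * n - 1) + 1)) x →L[ℝ] EuclideanSpace ℝ (Fin (4 * n)) :=
  mvfderiv (𝓡 (2 * (2 * n - 1) + 1)) (fun y : UnitSphere n => (y : EuclideanSpace ℝ (Fin (4 * n)))) x

theorem inducedForm_apply (A : Matrix (Fin (4 * n)) (Fin (4 * n)) ℝ) (x : UnitSphere n)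
    (v : TangentSpace (𝓡 (2 * (2 * n - 1) + 1)) x) :
    inducedForm n A x v = inner ℝ (Matrix.toEuclideanCLM (𝕜 := ℝ) A
      (x : EuclideanSpace ℝ (Fin (4 * n)))) (sphereIncl x v) :=
  rfl

theorem linComb_inducedForm {p : ℕ} (A : Fin (p + 1) → Matrix (Fin (4 * n)) (Fin (4 * n)) ℝ)
    (c : Fin (p + 1) → ℝ) :
    linComb (fun i => inducedForm n (A i)) c = inducedForm n (∑ i, c i • A i) := by
  funext x
  ext v
  simp [linComb, inducedForm_apply, sum_inner, inner_smul_left, map_sum]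

theorem inducedForm_isSmooth (A : Matrix (Fin (4 * n)) (Fin (4 * n)) ℝ) :
    (inducedForm n A).IsSmooth := by
  unfold OneForm.IsSmooth
  have hι : ContMDiff (𝓡 (2 * (2 * n - 1) + 1)) 𝓘(ℝ, EuclideanSpace ℝ (Fin (4 * n))) ∞
      (fun y : UnitSphere n => (y : EuclideanSpace ℝ (Fin (4 * n)))) := contMDiff_coe_sphere
  have h1 := (Matrix.toEuclideanCLM (𝕜 := ℝ) A).contDiff.contMDiff.comp (hι.comp
    (Bundle.contMDiff_proj (IB := 𝓡 (2 * (2 * n - 1) + 1)) (n := ∞)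
      (F := EuclideanSpace ℝ (Fin (2 * (2 * n - 1) + 1)))
      (TangentSpace (𝓡 (2 * (2 * n - 1) + 1)) : UnitSphere n → Type _)))
  have h2 := (contMDiff_snd_tangentBundle_modelSpace (EuclideanSpace ℝ (Fin (4 * n)))
    𝓘(ℝ, EuclideanSpace ℝ (Fin (4 * n))) (n := ∞)).comp (hι.contMDiff_tangentMap (m := ∞) le_rfl)
  exact contDiff_inner.contMDiff.comp (h1.prodMk_space h2)

/-- The ambient one-form `⟨Bx, dx⟩`. -/
noncomputable def ambientForm {E : Type*} [NormedAddCommGroup E] [InnerProductSpace ℝ E]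
    (B : E →L[ℝ] E) : E →L[ℝ] (E [⋀^Fin 1]→L[ℝ] ℝ) :=
  (ContinuousAlternatingMap.ofSubsingletonLIE (𝕜 := ℝ) (E := E) (F := ℝ)
    (i := (0 : Fin 1))).toContinuousLinearEquiv.toContinuousLinearMap ∘L (innerSL ℝ) ∘L B

theorem ambientForm_apply {E : Type*} [NormedAddCommGroup E] [InnerProductSpace ℝ E]
    (B : E →L[ℝ] E) (z : E) : ambientForm B z =
      ContinuousAlternatingMap.ofSubsingleton ℝ E ℝ (0 : Fin 1) (innerSL ℝ (B z)) :=
  rfl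

/-- The form depends linearly on the base point, so its derivative is itself and d is a plain
antisymmetrization. -/
theorem extDeriv_ambientForm {E : Type*} [NormedAddCommGroup E] [InnerProductSpace ℝ E]
    (B : E →L[ℝ] E) (z : E) (v : Fin 2 → E) :
    extDeriv (ambientForm B) z v = inner ℝ (B (v 0)) (v 1) - inner ℝ (B (v 1)) (v 0) := by
  rw [extDeriv, (ambientForm B).fderiv, ContinuousAlternatingMap.alternatizeUncurryFin_apply,
    Fin.sum_univ_two]
  simp [ambientForm_apply, Fin.removeNth, sub_eq_add_neg]
  rfl

theorem contMDiff_sphere_coe : ContMDiff (𝓡 (2 * (2 * n - 1) + 1))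
    𝓘(ℝ, EuclideanSpace ℝ (Fin (4 * n))) ∞
    (fun y : UnitSphere n => (y : EuclideanSpace ℝ (Fin (4 * n)))) :=
  contMDiff_coe_sphere

/-- The parametrization of the sphere by the inverse of the chart at `x`. -/
noncomputable def sphereParam (x : UnitSphere n) (y : EuclideanSpace ℝ (Fin (2 * (2 * n - 1) + 1))) :
    EuclideanSpace ℝ (Fin (4 * n)) :=
  ((extChartAt (𝓡 (2 * (2 * n - 1) + 1)) x).symm y : UnitSphere n)

theorem contMDiffAt_extChartAt_symm_sphere (x : UnitSphere n)
    {y : EuclideanSpace ℝ (Fin (2 * (2 * n - 1) + 1))}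
    (hy : y ∈ (extChartAt (𝓡 (2 * (2 * n - 1) + 1)) x).target) :
    ContMDiffAt 𝓘(ℝ, EuclideanSpace ℝ (Fin (2 * (2 * n - 1) + 1))) (𝓡 (2 * (2 * n - 1) + 1)) ∞
      (extChartAt (𝓡 (2 * (2 * n - 1) + 1)) x).symm y :=
  (contMDiffOn_extChartAt_symm x).contMDiffAt (extChartAt_target_mem_nhds' hy)

theorem contDiffAt_sphereParam (x : UnitSphere n)
    {y : EuclideanSpace ℝ (Fin (2 * (2 * n - 1) + 1))}
    (hy : y ∈ (extChartAt (𝓡 (2 * (2 * n - 1) + 1)) x).target) :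
    ContDiffAt ℝ ∞ (sphereParam x) y :=
  (contMDiff_sphere_coe.contMDiffAt.comp y (contMDiffAt_extChartAt_symm_sphere x hy)).contDiffAt

theorem fderiv_sphereParam (x : UnitSphere n)
    {y : EuclideanSpace ℝ (Fin (2 * (2 * n - 1) + 1))}
    (hy : y ∈ (extChartAt (𝓡 (2 * (2 * n - 1) + 1)) x).target) :
    fderiv ℝ (sphereParam x) y =
      (sphereIncl ((extChartAt (𝓡 (2 * (2 * n - 1) + 1)) x).symm y)).comp
        (mfderiv 𝓘(ℝ, EuclideanSpace ℝ (Fin (2 * (2 * n - 1) + 1))) (𝓡 (2 * (2 * n - 1) + 1))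
          (extChartAt (𝓡 (2 * (2 * n - 1) + 1)) x).symm y) := by
  rw [← mfderiv_eq_fderiv]
  exact mfderiv_comp y (contMDiff_sphere_coe.mdifferentiable (by simp) _)
    ((contMDiffAt_extChartAt_symm_sphere x hy).mdifferentiableAt (by simp))

/-- Chain rule: near x, the parametrization composed with the chart is the inclusion of the sphere.
-/
theorem fderiv_sphereParam_comp (x : UnitSphere n)
    (v : TangentSpace (𝓡 (2 * (2 * n - 1) + 1)) x) :
    fderiv ℝ (sphereParam x) (extChartAt (𝓡 (2 * (2 * n - 1) + 1)) x x)
      (mfderiv (𝓡 (2 * (2 * n - 1) + 1)) 𝓘(ℝ, EuclideanSpace ℝ (Fin (2 * (2 * n - 1) + 1)))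
        (extChartAt (𝓡 (2 * (2 * n - 1) + 1)) x) x v) = sphereIncl x v := by
  have h1 := mfderiv_comp x (I := 𝓡 (2 * (2 * n - 1) + 1))
    (I' := 𝓘(ℝ, EuclideanSpace ℝ (Fin (2 * (2 * n - 1) + 1))))
    (I'' := 𝓘(ℝ, EuclideanSpace ℝ (Fin (4 * n))))
    (((contDiffAt_sphereParam x (mem_extChartAt_target x)).contMDiffAt).mdifferentiableAt (by simp))
    (mdifferentiableAt_extChartAt (mem_chart_source _ x))
  have h2 : (sphereParam x ∘ extChartAt (𝓡 (2 * (2 * n - 1) + 1)) x) =ᶠ[nhds x]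
      fun y : UnitSphere n => (y : EuclideanSpace ℝ (Fin (4 * n))) := by
    filter_upwards [extChartAt_source_mem_nhds (I := 𝓡 (2 * (2 * n - 1) + 1)) x] with y hy
    rw [Function.comp_apply, sphereParam, (extChartAt _ x).left_inv hy]
  rw [h2.mfderiv_eq, mfderiv_eq_fderiv] at h1
  exact (congrArg (fun L => L v) h1).symm

theorem inChart_inducedForm (A : Matrix (Fin (4 * n)) (Fin (4 * n)) ℝ) (x : UnitSphere n)
    {y : EuclideanSpace ℝ (Fin (2 * (2 * n - 1) + 1))}
    (hy : y ∈ (extChartAt (𝓡 (2 * (2 * n - 1) + 1)) x).target) :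
    (inducedForm n A).inChart x y =
      (ambientForm (Matrix.toEuclideanCLM (𝕜 := ℝ) A) (sphereParam x y)).compContinuousLinearMap
        (fderiv ℝ (sphereParam x) y) := by
  rw [fderiv_sphereParam x hy]
  rfl

/-- Naturality of d: in the chart the form is the pull-back of `ambientForm` by `sphereParam`, and
pulling back once more by the chart gives the inclusion. -/
theorem extD_inducedForm (A : Matrix (Fin (4 * n)) (Fin (4 * n)) ℝ) (x : UnitSphere n)
    (v : Fin 2 → TangentSpace (𝓡 (2 * (2 * n - 1) + 1)) x) :
    (inducedForm n A).extD x v =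
      inner ℝ (Matrix.toEuclideanCLM (𝕜 := ℝ) A (sphereIncl x (v 0))) (sphereIncl x (v 1)) -
      inner ℝ (Matrix.toEuclideanCLM (𝕜 := ℝ) A (sphereIncl x (v 1))) (sphereIncl x (v 0)) := by
  have h : (inducedForm n A).inChart x =ᶠ[nhds (extChartAt (𝓡 (2 * (2 * n - 1) + 1)) x x)] _ :=
    Filter.eventually_of_mem (extChartAt_target_mem_nhds x) fun y hy => inChart_inducedForm A x hy
  rw [OneForm.extD, h.extDeriv_eq, extDeriv_pullback
    (ambientForm (Matrix.toEuclideanCLM (𝕜 := ℝ) A)).differentiableAt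
    (contDiffAt_sphereParam x (mem_extChartAt_target x))
    (by rw [minSmoothness_of_isRCLikeNormedField]; exact WithTop.coe_le_coe.2 (le_top : (2 : ℕ∞) ≤ ⊤))]
  rw [← fderiv_sphereParam_comp, ← fderiv_sphereParam_comp]
  exact extDeriv_ambientForm _ _ _

end Sphere

/-! ### Contact spheres from anticommuting complex structures -/

section ContactSphere

variable {n : ℕ} [NeZero n]

theorem isOrthogonalComplexStructure_toEuclideanCLM {N : ℕ} {A : Matrix (Fin N) (Fin N) ℝ}
    (hA : A.transpose = -A) (hA2 : A * A = -1) :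
    IsOrthogonalComplexStructure (Matrix.toEuclideanCLM (𝕜 := ℝ) A) where
  skew u v := by
    rw [← ContinuousLinearMap.adjoint_inner_right, ← ContinuousLinearMap.star_eq_adjoint,
      ← map_star, Matrix.star_eq_conjTranspose, Matrix.conjTranspose_eq_transpose_of_trivial, hA,
      map_neg, _root_.neg_apply, inner_neg_right]
  sq u := by
    rw [← mul_apply_eq_comp, ← map_mul, hA2, map_neg, map_one]
    rfl

theorem IsEckmannFamily.transpose_linComb {N p : ℕ} {A : Fin p → Matrix (Fin N) (Fin N) ℝ}
    (hA : IsEckmannFamily A) (c : Fin p → ℝ) :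
    (∑ i, c i • A i).transpose = -∑ i, c i • A i := by
  simp [Matrix.transpose_sum, hA.antisymm]

theorem IsEckmannFamily.linComb_sq {N p : ℕ} {A : Fin p → Matrix (Fin N) (Fin N) ℝ}
    (hA : IsEckmannFamily A) (c : Fin p → ℝ) (hc : ∑ i, c i ^ 2 = 1) :
    (∑ i, c i • A i) * ∑ i, c i • A i = -1 := by
  have hmul : ∀ i j, A i * A j + A j * A i = if i = j then (-2 : ℝ) • 1 else 0 := by
    intro i j
    split_ifs with h
    · rw [h, hA.sq, neg_smul, two_smul, neg_add]
    · exact hA.anticomm i j h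
  have h1 : (∑ i, c i • A i) * ∑ i, c i • A i = ∑ i, ∑ j, (c i * c j) • (A i * A j) := by
    simp [Finset.sum_mul_sum, smul_smul, mul_comm]
  have h2 : ∑ i, ∑ j, (c i * c j) • (A i * A j) = ∑ i, ∑ j, (c i * c j) • (A j * A i) := by
    rw [Finset.sum_comm]
    simp only [mul_comm]
  -- Adding the double sum to its transpose leaves only the diagonal, by the Clifford relations
  -- `hmul`.
  have h3 : (2 : ℝ) • ∑ i, ∑ j, (c i * c j) • (A i * A j) = (2 : ℝ) • -1 := by
    rw [two_smul]
    nth_rewrite 2 [h2]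
    simp only [← Finset.sum_add_distrib, ← smul_add, hmul, smul_ite, smul_zero,
      Finset.sum_ite_eq, Finset.mem_univ, if_true, ← Finset.sum_smul, ← pow_two, hc, one_smul]
    simp
  rw [h1]
  exact smul_right_injective _ (two_ne_zero (α := ℝ)) h3

theorem IsEckmannFamily.isOrthogonalComplexStructure {N p : ℕ}
    {A : Fin p → Matrix (Fin N) (Fin N) ℝ} (hA : IsEckmannFamily A) (c : Fin p → ℝ)
    (hc : ∑ i, c i ^ 2 = 1) :
    IsOrthogonalComplexStructure (Matrix.toEuclideanCLM (𝕜 := ℝ) (∑ i, c i • A i)) :=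
  isOrthogonalComplexStructure_toEuclideanCLM (hA.transpose_linComb c) (hA.linComb_sq c hc)

theorem inner_sphereIncl (x : UnitSphere n) (v : TangentSpace (𝓡 (2 * (2 * n - 1) + 1)) x) :
    inner ℝ (x : EuclideanSpace ℝ (Fin (4 * n))) (sphereIncl x v) = 0 := by
  have h : sphereIncl x v ∈ (sphereIncl x).range := ⟨v, rfl⟩
  rw [range_mvfderiv_subtypeVal x] at h
  exact Submodule.mem_orthogonal_singleton_iff_inner_right.1 h

theorem exists_sphereIncl_eq (x : UnitSphere n) {w : EuclideanSpace ℝ (Fin (4 * n))}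
    (hw : inner ℝ (x : EuclideanSpace ℝ (Fin (4 * n))) w = 0) :
    ∃ v, sphereIncl x v = w := by
  have h : w ∈ (sphereIncl x).range := by
    rw [range_mvfderiv_subtypeVal x]
    exact Submodule.mem_orthogonal_singleton_iff_inner_right.2 hw
  exact h

theorem extD_inducedForm_of_isOrthogonalComplexStructure
    {A : Matrix (Fin (4 * n)) (Fin (4 * n)) ℝ}
    (hA : IsOrthogonalComplexStructure (Matrix.toEuclideanCLM (𝕜 := ℝ) A)) (x : UnitSphere n)
    (v : Fin 2 → TangentSpace (𝓡 (2 * (2 * n - 1) + 1)) x) :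
    (inducedForm n A).extD x v = 2 *
      inner ℝ (Matrix.toEuclideanCLM (𝕜 := ℝ) A (sphereIncl x (v 0))) (sphereIncl x (v 1)) := by
  rw [extD_inducedForm, hA.skew (sphereIncl x (v 1)), real_inner_comm]
  ring

/-- The point is that the right-hand side is independent of A. -/
theorem contactVolume_inducedForm_sq {A : Matrix (Fin (4 * n)) (Fin (4 * n)) ℝ}
    (hA : IsOrthogonalComplexStructure (Matrix.toEuclideanCLM (𝕜 := ℝ) A)) (x : UnitSphere n)
    (v : Fin (1 + 2 * (2 * n - 1)) → TangentSpace (𝓡 (2 * (2 * n - 1) + 1)) x) :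
    ((inducedForm n A).contactVolume (2 * n - 1) x v) ^ 2 =
      (2 ^ (2 * n - 1) * (2 * n - 1).factorial) ^ 2 *
        (Matrix.gram ℝ fun i => sphereIncl x (v i)).det := by
  have hn := NeZero.pos n
  have hd : Module.finrank ℝ (EuclideanSpace ℝ (Fin (4 * n))) = 2 * (2 * n - 1 + 1) := by
    rw [finrank_euclideanSpace_fin]
    omega
  let S := TangentSpace (𝓡 (2 * (2 * n - 1) + 1)) x
  have h := hA.wedge_wedgePow_sq hd (norm_eq_of_mem_sphere x)
    (sphereIncl x : S →ₗ[ℝ] EuclideanSpace ℝ (Fin (4 * n))) (inner_sphereIncl x)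
    (inducedForm n A x : S →ₗ[ℝ] ℝ) (fun _ => rfl) ((inducedForm n A).extD x).toAlternatingMap
    (extD_inducedForm_of_isOrthogonalComplexStructure hA x) v
  rw [OneForm.contactVolume, h]
  rfl

/-- On a basis of the tangent space the Gram determinant is positive, the inclusion being an
immersion. -/
theorem contactVolume_inducedForm_ne_zero {A : Matrix (Fin (4 * n)) (Fin (4 * n)) ℝ}
    (hA : IsOrthogonalComplexStructure (Matrix.toEuclideanCLM (𝕜 := ℝ) A)) (x : UnitSphere n) :
    (inducedForm n A).contactVolume (2 * n - 1) x ≠ 0 := by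
  intro h
  let S := TangentSpace (𝓡 (2 * (2 * n - 1) + 1)) x
  have hfin : FiniteDimensional ℝ S :=
    inferInstanceAs (FiniteDimensional ℝ (EuclideanSpace ℝ (Fin (2 * (2 * n - 1) + 1))))
  have hrank : Module.finrank ℝ S = 1 + 2 * (2 * n - 1) :=
    (finrank_euclideanSpace_fin (𝕜 := ℝ) (n := 2 * (2 * n - 1) + 1)).trans (add_comm _ _)
  let b : Module.Basis (Fin (1 + 2 * (2 * n - 1))) ℝ S := Module.finBasisOfFinrankEq ℝ S hrank
  have hb : LinearIndependent ℝ fun i => sphereIncl x (b i) :=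
    b.linearIndependent.map' (sphereIncl x : S →ₗ[ℝ] EuclideanSpace ℝ (Fin (4 * n)))
      (LinearMap.ker_eq_bot.2 (injective_mvfderiv_subtypeVal_sphere x))
  have h1 := contactVolume_inducedForm_sq hA x b
  have h2 := (Matrix.posDef_gram_of_linearIndependent hb).det_pos
  have h3 : (0 : ℝ) < 2 ^ (2 * n - 1) * (2 * n - 1).factorial := by positivity
  rw [h, AlternatingMap.zero_apply] at h1
  have := mul_pos (pow_pos h3 2) h2
  rw [← h1] at this
  simp at this

/-- ω(Ax) = |Ax|² = 1, and dω(Ax, v) = 2⟨A²x, v⟩ = −2⟨x, v⟩ = 0 for v tangent at x. -/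
theorem isReebField_inducedForm {A : Matrix (Fin (4 * n)) (Fin (4 * n)) ℝ}
    (hA : IsOrthogonalComplexStructure (Matrix.toEuclideanCLM (𝕜 := ℝ) A))
    (R : (x : UnitSphere n) → TangentSpace (𝓡 (2 * (2 * n - 1) + 1)) x)
    (hR : ∀ x : UnitSphere n, sphereIncl x (R x) =
      Matrix.toEuclideanCLM (𝕜 := ℝ) A (x : EuclideanSpace ℝ (Fin (4 * n)))) :
    (inducedForm n A).IsReebField R := by
  refine fun x => ⟨?_, fun v => ?_⟩
  · rw [inducedForm_apply, hR, hA.inner_map_map, real_inner_self_eq_norm_sq,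
      norm_eq_of_mem_sphere, one_pow]
  · rw [extD_inducedForm_of_isOrthogonalComplexStructure hA]
    simp only [Matrix.cons_val_zero, Matrix.cons_val_one]
    rw [hR, hA.sq, inner_neg_left, inner_sphereIncl, neg_zero, mul_zero]

theorem IsEckmannFamily.isContactSphere {p : ℕ}
    {A : Fin (p + 1) → Matrix (Fin (4 * n)) (Fin (4 * n)) ℝ} (hA : IsEckmannFamily A) :
    IsContactSphere (fun i => inducedForm n (A i)) := fun c hc => by
  rw [linComb_inducedForm]
  exact ⟨inducedForm_isSmooth _,
    contactVolume_inducedForm_ne_zero (hA.isOrthogonalComplexStructure c hc)⟩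

theorem IsEckmannFamily.isRound {p : ℕ}
    {A : Fin (p + 1) → Matrix (Fin (4 * n)) (Fin (4 * n)) ℝ} (hA : IsEckmannFamily A) :
    IsRound (fun i => inducedForm n (A i)) := by
  have hAi : ∀ i, IsOrthogonalComplexStructure (Matrix.toEuclideanCLM (𝕜 := ℝ) (A i)) := fun i =>
    isOrthogonalComplexStructure_toEuclideanCLM (hA.antisymm i) (hA.sq i)
  -- Since Aᵢ is skew, Aᵢ x is orthogonal to x, hence tangent to the sphere.
  choose R hR using fun (i : Fin (p + 1)) (x : UnitSphere n) =>
    exists_sphereIncl_eq x ((hAi i).inner_self_map (x : EuclideanSpace ℝ (Fin (4 * n))))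
  refine ⟨R, fun i => isReebField_inducedForm (hAi i) _ (hR i), fun c hc => ?_⟩
  rw [linComb_inducedForm]
  refine isReebField_inducedForm (hA.isOrthogonalComplexStructure c hc) _ fun x => ?_
  simp [map_sum, hR]

/-- For p = 0 the set is a pair of points, so the bound on p is essential. -/
theorem isPreconnected_sum_sq_eq_one {p : ℕ} (hp : 1 ≤ p) :
    IsPreconnected {c : Fin (p + 1) → ℝ | ∑ i, c i ^ 2 = 1} := by
  have h : IsPreconnected (Metric.sphere (0 : EuclideanSpace ℝ (Fin (p + 1))) 1) := by
    refine isPreconnected_sphere ?_ 0 1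
    rw [← Module.finrank_eq_rank, finrank_euclideanSpace_fin]
    exact_mod_cast Nat.lt_succ_of_le hp
  have h' := h.image (EuclideanSpace.equiv (Fin (p + 1)) ℝ)
    (EuclideanSpace.equiv (Fin (p + 1)) ℝ).continuous.continuousOn
  convert h' using 1
  rw [(EuclideanSpace.equiv (Fin (p + 1)) ℝ).image_eq_preimage_symm]
  ext c
  simp [EuclideanSpace.norm_eq]

theorem continuous_contactVolume_inducedForm {p : ℕ}
    (A : Fin (p + 1) → Matrix (Fin (4 * n)) (Fin (4 * n)) ℝ) (x : UnitSphere n)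
    (v : Fin (1 + 2 * (2 * n - 1)) → TangentSpace (𝓡 (2 * (2 * n - 1) + 1)) x) :
    Continuous fun c : Fin (p + 1) → ℝ =>
      (inducedForm n (∑ i, c i • A i)).contactVolume (2 * n - 1) x v := by
  refine continuous_wedge (fun u => ?_) (fun u => continuous_wedgePow (fun w => ?_) _ u) v
  · change Continuous fun c : Fin (p + 1) → ℝ => inducedForm n (∑ i, c i • A i) x (u 0)
    simp only [inducedForm_apply, map_sum, map_smul, sum_inner, _root_.sum_apply,
      _root_.smul_apply, real_inner_smul_left]
    fun_prop
  · change Continuous fun c : Fin (p + 1) → ℝ => (inducedForm n (∑ i, c i • A i)).extD x w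
    simp only [extD_inducedForm, map_sum, map_smul, sum_inner, _root_.sum_apply,
      _root_.smul_apply, real_inner_smul_left]
    fun_prop

/-- On fixed vectors the volume is a continuous function of the coefficients with constant square on
a connected sphere. If that square is nonzero the function has constant sign, hence is constant. -/
theorem IsEckmannFamily.isTaut {p : ℕ} (hp : 1 ≤ p)
    {A : Fin (p + 1) → Matrix (Fin (4 * n)) (Fin (4 * n)) ℝ} (hA : IsEckmannFamily A) :
    IsTaut (fun i => inducedForm n (A i)) := by
  intro c c' hc hc' x
  rw [linComb_inducedForm, linComb_inducedForm]
  ext v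
  have hsq : ∀ d : Fin (p + 1) → ℝ, ∑ i, d i ^ 2 = 1 → _ := fun d hd =>
    contactVolume_inducedForm_sq (hA.isOrthogonalComplexStructure d hd) x v
  by_cases h0 : (inducedForm n (∑ i, c' i • A i)).contactVolume (2 * n - 1) x v = 0
  · have h1 := hsq c' hc'
    rw [h0, zero_pow two_ne_zero, ← hsq c hc, eq_comm, pow_eq_zero_iff two_ne_zero] at h1
    rw [h0, h1]
  · rcases (isPreconnected_sum_sq_eq_one hp).eq_or_eq_neg_of_sq_eq
      (continuous_contactVolume_inducedForm A x v).continuousOn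
      (continuousOn_const (c := (inducedForm n (∑ i, c' i • A i)).contactVolume (2 * n - 1) x v))
      (fun d hd => (hsq d hd).trans (hsq c' hc').symm) (fun _ => h0) with h | h
    · exact h hc
    · exact absurd (self_eq_neg.1 (h hc')) h0

/-- Supplies the connectedness hypothesis 1 ≤ p for p = ρ(4n) − 1. Either the valuation is 2 or 3
and 2^c ≥ 4, or d ≥ 1 and 8d dominates. -/
theorem one_lt_hurwitzRadonAdams (n : ℕ) [NeZero n] : 1 < hurwitzRadonAdams (4 * n) := by
  have hv : 2 ≤ padicValNat 2 (4 * n) := by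
    rw [← padicValNat_dvd_iff_le (mul_ne_zero (by norm_num) (NeZero.ne n))]
    exact Dvd.intro n (by norm_num)
  unfold hurwitzRadonAdams
  generalize padicValNat 2 (4 * n) = v at hv
  have h1 : 1 ≤ 2 ^ (v % 4) := Nat.one_le_two_pow
  rcases Nat.eq_zero_or_pos (v / 4) with h | h
  · have h2 : 2 ^ 2 ≤ 2 ^ (v % 4) := Nat.pow_le_pow_right (by norm_num) (by omega)
    omega
  · omega

end ContactSphere

theorem mainTheorem5 (n : ℕ) [NeZero n] :
    (∃ A : Fin (hurwitzRadonAdams (4 * n) - 1 + 1) → Matrix (Fin (4 * n)) (Fin (4 * n)) ℝ,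
      IsEckmannFamily A) ∧
    ∀ A : Fin (hurwitzRadonAdams (4 * n) - 1 + 1) → Matrix (Fin (4 * n)) (Fin (4 * n)) ℝ,
      IsEckmannFamily A →
        IsContactSphere (fun i => inducedForm n (A i)) ∧
        IsRound (fun i => inducedForm n (A i)) ∧
        IsTaut (fun i => inducedForm n (A i)) :=
  ⟨exists_isEckmannFamily n, fun _ hA => ⟨hA.isContactSphere, hA.isRound,
    hA.isTaut (Nat.le_sub_one_of_lt (one_lt_hurwitzRadonAdams n))⟩⟩
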